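/- Define $\varphi_0(z)=e^z$ and $\varphi_j(z)=\int_0^1 e^{(1-s)z}\frac{s^{j-1}}{(j-1)!}\,ds$ for $j\ge 1$. For $c_2\in(0,1]$, the EERK3-1 method of Hochbruck and Ostermann is the three-stage explicit exponential Runge–Kutta method with coefficients $$a_{21}(z)=c_2\varphi_1(c_2z),\quad a_{31}(z)=\tfrac23\varphi_1(\tfrac{2z}{3})-\tfrac{4}{9c_2}\varphi_2(\tfrac{2z}{3}),\quad a_{32}(z)=\tfrac{4}{9c_2}\varphi_2(\tfrac{2z}{3}),$$ $$a_{41}(z)=\varphi_1(z)-\tfrac32\varphi_2(z),\quad a_{42}(z)=0,\quad a_{43}(z)=\tfrac32\varphi_2(z).$$ *Differentiation matrix.* Put $\underline a_{i+1,i}=a_{i+1,i}$ and $\underline a_{i+1,j}=a_{i+1,j}-a_{i,j}$ for $1\le j\le i-1$; $\underline\theta_{k,k}=1/\underline a_{k+1,k}$ and $\underline\theta_{k,j}=-\sum_{\ell=j+1}^{k}\underline\theta_{k,\ell}\,\underline a_{\ell+1,j}/\underline a_{j+1,j}$ for $1\le j\le k-1$; $d_{k\ell}(z)=\underline\theta_{k,\ell}(z)+\frac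 z2(2-\delta_{k\ell})$ for $1\le\ell\le k\le 3$ and $d_{k\ell}(z)=0$ for $\ell>k$. Let $D^{(3,1)}(c_2,z)=(d_{k\ell}(z))_{3\times3}$. *Problem and scheme.* Let $L_h$ be a real symmetric positive definite matrix acting on a finite-dimensional space of grid functions with inner product $\langle u,v\rangle=v^Tu$. Let $G_h$ be a vector-valued function with non-negative entries such that $v\mapsto\langle G_h(v),1\rangle$ is differentiable with gradient $-g_h(v)$, and let $g_h$ be Lipschitz continuous with constant $\ell_g>0$. Let $E[v]=\frac12\langle v,L_hv\rangle+\langle G_h(v),1\rangle$, $\kappa\ge 2\ell_g$, $L_\kappa=L_h+\kappa I$ and $g_\kappa(v)=g_h(v)+\kappa v$. With arbitrary (possibly variable) step sizes $\tau=\tau_n>0$ and an arbitrary initial value $u_h^0$, the method computes, for $n\ge1$, $U^{n,1}=u_h^{n-1}$, $$U^{n,i+1}=U^{n,1}+\sum_{j=1}^{i}a_{i+1,j}(-\tau L_\kappa)\big[\tau g_\kappa(U^{n,j})-\tau L_\kappa U^{n,1}\big]\quad(1\le i\le 3),\qquad u_h^n=U^{n,4},$$ where a function of the symmetric matrix $-\tau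 L_\kappa$ is taken on its spectrum. Write $\delta_\tau U^{n,k+1}=U^{n,k+1}-U^{n,k}$. **Claim.** Let $c_2\in[\frac49,1]$. (a) For every $z<0$, $$D^{(3,1)}(c_2,z)=\begin{pmatrix}\frac{1}{c_2\varphi_1(c_2z)}+\frac z2&0&0\\ \frac{9c_2}{4\varphi_2(\frac{2z}3)}+\frac1{c_2\varphi_1(c_2z)}-\frac{3\varphi_1(\frac{2z}3)}{2\varphi_2(\frac{2z}3)\varphi_1(c_2z)}+z&\frac{9c_2}{4\varphi_2(\frac{2z}3)}+\frac z2&0\\ \frac{2c_2\varphi_1(c_2z)-2\varphi_1(z)+3\varphi_2(z)}{3c_2\varphi_1(c_2z)\varphi_2(z)}+z&\frac{2}{3\varphi_2(z)}+z&\frac{2}{3\varphi_2(z)}+\frac z2\end{pmatrix},$$ and the symmetric part $\frac12\big(D^{(3,1)}(c_2,z)+D^{(3,1)}(c_2,z)^T\big)$ is positive definite. (b) The EERK3-1 method preserves the energy dissipation law at all stages, without any restriction on the step sizes: for all $n\ge1$ and $1\le j\le3$, $$E[U^{n,j+1}]-E[U^{n,1}]\le-\frac1\tau\sum_{k=1}^{j}\Big\langle\delta_\tau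 U^{n,k+1},\sum_{\ell=1}^{k}d_{k\ell}(-\tau L_\kappa)\,\delta_\tau U^{n,\ell+1}\Big\rangle,$$ where the double sum on the right is non-negative, so that $E[U^{n,j+1}]\le E[U^{n,1}]$; in particular $E[u_h^n]\le E[u_h^{n-1}]$. -/

import Mathlib

open scoped NNReal

noncomputable section

namespace EERK

/-- The functions `φ₀(z) = e^z` and `φ_j(z) = ∫₀¹ e^{(1-s)z} s^{j-1}/(j-1)! ds` for `j ≥ 1`. -/
def phi : ℕ → ℝ → ℝ
  | 0, z => Real.exp z
  | j + 1, z => ∫ s in (0 : ℝ)..1, Real.exp ((1 - s) * z) * (s ^ j / (j.factorial : ℝ))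

/-! The coefficients of an explicit exponential Runge-Kutta method are a family
`a i j : ℝ → ℝ`, with the indices `2 ≤ i ≤ s + 1`, `1 ≤ j ≤ i - 1` of the Butcher tableau;
the row `i = s + 1` contains the weights. -/

/-- Difference coefficients: `a̲_{i+1,i} = a_{i+1,i}` and
`a̲_{i+1,j} = a_{i+1,j} - a_{i,j}` for `1 ≤ j ≤ i - 1`. -/
def diffCoeff (a : ℕ → ℕ → ℝ → ℝ) (i j : ℕ) (z : ℝ) : ℝ :=
  if i = j + 1 then a i j z else a i j z - a (i - 1) j z

/-- Discrete orthogonal convolution kernels: `θ_{k,k} = 1 / a̲_{k+1,k}` and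
`θ_{k,j} = -∑_{ℓ=j+1}^k θ_{k,ℓ} a̲_{ℓ+1,j} / a̲_{j+1,j}` for `1 ≤ j ≤ k - 1`. -/
def docKernel (a : ℕ → ℕ → ℝ → ℝ) (k j : ℕ) (z : ℝ) : ℝ :=
  if k ≤ j then 1 / diffCoeff a (k + 1) k z
  else -∑ l : {l // l ∈ Finset.Icc (j + 1) k},
    docKernel a k l.1 z * (diffCoeff a (l.1 + 1) j z / diffCoeff a (j + 1) j z)
termination_by k - j
decreasing_by
  have := Finset.mem_Icc.mp l.2
  omega

/-- `d_{kℓ}(z) = θ_{kℓ}(z) + (z/2)(2 - δ_{kℓ})` for `ℓ ≤ k`, and `0` for `ℓ > k`. -/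
def dEntry (a : ℕ → ℕ → ℝ → ℝ) (k l : ℕ) (z : ℝ) : ℝ :=
  if l ≤ k then docKernel a k l z + z / 2 * (2 - if k = l then 1 else 0) else 0

/-- The differentiation matrix `D(z) = (d_{kℓ}(z))` of an `s`-stage method;
the row with index `k : Fin s` is row number `k + 1`. -/
def diffMatrix (a : ℕ → ℕ → ℝ → ℝ) (s : ℕ) (z : ℝ) : Matrix (Fin s) (Fin s) ℝ :=
  Matrix.of fun k l => dEntry a (k + 1) (l + 1) z

/-- The symmetric part of a square matrix. -/
def symPart {s : ℕ} (D : Matrix (Fin s) (Fin s) ℝ) : Matrix (Fin s) (Fin s) ℝ :=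
  (1 / 2 : ℝ) • (D + D.transpose)

/-- The Butcher tableau of the EERK3-1 method with abscissas `0, c₂, 2/3`. -/
def eerk31 (c₂ : ℝ) : ℕ → ℕ → ℝ → ℝ
  | 2, 1, z => c₂ * phi 1 (c₂ * z)
  | 3, 1, z => 2 / 3 * phi 1 (2 / 3 * z) - 4 / (9 * c₂) * phi 2 (2 / 3 * z)
  | 3, 2, z => 4 / (9 * c₂) * phi 2 (2 / 3 * z)
  | 4, 1, z => phi 1 z - 3 / 2 * phi 2 z
  | 4, 2, _ => 0
  | 4, 3, z => 3 / 2 * phi 2 z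
  | _, _, _ => 0

section Problem

variable {ι : Type*} [Fintype ι] [DecidableEq ι]

/-- `f(A) v` for a symmetric matrix `A`, a real function `f` on its (finite) spectrum and a
vector `v`, by the spectral functional calculus. -/
def matFun (f : ℝ → ℝ) (A : Matrix ι ι ℝ) (v : EuclideanSpace ℝ ι) : EuclideanSpace ℝ ι :=
  Matrix.toEuclideanLin (cfc f A) v

/-- The stabilized matrix `L_κ = L + κ I`. -/
def stabMatrix (L : Matrix ι ι ℝ) (κ : ℝ) : Matrix ι ι ℝ := L + κ • (1 : Matrix ι ι ℝ)

/-- The stabilized nonlinearity `g_κ(v) = g(v) + κ v`. -/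
def stabNonlin (g : EuclideanSpace ℝ ι → EuclideanSpace ℝ ι) (κ : ℝ)
    (v : EuclideanSpace ℝ ι) : EuclideanSpace ℝ ι := g v + κ • v

/-- The energy `E[v] = ½⟨v, L v⟩ + ⟨G(v), 1⟩`. -/
def energy (L : Matrix ι ι ℝ) (G : EuclideanSpace ℝ ι → ι → ℝ) (v : EuclideanSpace ℝ ι) : ℝ :=
  1 / 2 * inner ℝ v (Matrix.toEuclideanLin L v) + ∑ i, G v i

/-- `U 1, …, U (s + 1)` are the stages of one step of length `τ` of the `s`-stage method with
coefficients `a`, applied to `u' = -L_κ u + g_κ(u)` and started from `U 1`: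
`U (i+1) = U 1 + ∑_{j=1}^i a_{i+1,j}(-τ L_κ) [τ g_κ(U j) - τ L_κ U 1]` for `1 ≤ i ≤ s`. -/
def IsStep (a : ℕ → ℕ → ℝ → ℝ) (s : ℕ) (L : Matrix ι ι ℝ)
    (g : EuclideanSpace ℝ ι → EuclideanSpace ℝ ι) (κ τ : ℝ)
    (U : ℕ → EuclideanSpace ℝ ι) : Prop :=
  ∀ i ∈ Finset.Icc 1 s, U (i + 1) = U 1 + ∑ j ∈ Finset.Icc 1 i,
    matFun (a (i + 1) j) (-τ • stabMatrix L κ)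
      (τ • stabNonlin g κ (U j) - τ • Matrix.toEuclideanLin (stabMatrix L κ) (U 1))

/-- `u 0, u 1, …` is the numerical solution with (variable) step sizes `τ n`, and `U n i` is
stage `i` of the step from `u (n - 1)` to `u n`. -/
def IsNumericalSolution (a : ℕ → ℕ → ℝ → ℝ) (s : ℕ) (L : Matrix ι ι ℝ)
    (g : EuclideanSpace ℝ ι → EuclideanSpace ℝ ι) (κ : ℝ) (τ : ℕ → ℝ)
    (u : ℕ → EuclideanSpace ℝ ι) (U : ℕ → ℕ → EuclideanSpace ℝ ι) : Prop :=
  ∀ n, 1 ≤ n → U n 1 = u (n - 1) ∧ IsStep a s L g κ (τ n) (U n) ∧ u n = U n (s + 1)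

/-- `∑_{k=1}^j ⟨δU^{k+1}, ∑_{ℓ=1}^k d_{kℓ}(-τ L_κ) δU^{ℓ+1}⟩` with `δU^{k+1} = U^{k+1} - U^k`. -/
def dissipation (a : ℕ → ℕ → ℝ → ℝ) (L : Matrix ι ι ℝ) (κ τ : ℝ)
    (U : ℕ → EuclideanSpace ℝ ι) (j : ℕ) : ℝ :=
  ∑ k ∈ Finset.Icc 1 j, inner ℝ (U (k + 1) - U k)
    (∑ l ∈ Finset.Icc 1 k,
      matFun (dEntry a k l) (-τ • stabMatrix L κ) (U (l + 1) - U l))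

end Problem

end EERK

end

/-!
The energy law and the matrix inequality meet in the eigenbasis of `-τ L_κ`, whose eigenvalues are
negative.

*Energy law.* The kernels `θ` invert the difference coefficients of the method, so that a step can
be written in differential form
`∑_{ℓ ≤ k} d_{kℓ}(-τ L_κ) δU^{ℓ+1} = τ g_κ(U^k) - τ L_κ (U^k + U^{k+1}) / 2`
(`sum_dEntry_mul_sub` for one eigenvalue, `sum_matFun_dEntry` for the vectors). The inner product
with `δU^{k+1}` gives the change of the quadratic part of the energy exactly and controls that of
the nonlinear part, up to a remainder `(ℓ_g - κ/2) ‖δU^{k+1}‖² ≤ 0` (`energy_sub_le`). Summation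
over `k` is the dissipation law (`energy_sub_le_dissipation`), and the dissipation is a sum, over
the eigenvalues, of values of the quadratic form of the differentiation matrix
(`dissipation_nonneg`).

*Positive definiteness.* Let `z = -w`. If `a̲` is the lower triangular matrix of the difference
coefficients, then `⟨x, D(z) x⟩ = ⟨x, a̲⁻¹ x⟩ - (w/2) (x₁ + x₂ + x₃)²`, and at `x = a̲ y` this is
`⟨y, a̲ y⟩ - (w/2) (a₄₁ y₁ + a₄₂ y₂ + a₄₃ y₃)²`, because the column sums of `a̲` are the weights of
the method. Since `a₄₂ = 0`, completing the square in `y₂` leaves a binary form (`quadForm_pos`).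
Put `T = e^{-w}`, `a = e^{-2w/3}`, `e = e^{-c₂w}` and the scalars `y = φ₁(-w)`, `A = φ₁(-2w/3)`,
`r = (3y - 1) / 2` and `b = 2 (1 - A) / (3 c₂)`. After scaling by `w`, four times the
determinant of the binary form simplifies to
`(1 - T²) (1 - r² - b/2) - (a - r T) (e - r T) - (a - e)² (1 - r²) / (2b)`.
For `c₂ ≥ 4/9` one has `1 - r² - b/2 ≥ (9/4) y (1 - y)`, where the limit of the left-hand side as
`w → ∞` is `1 - 4 / (9 c₂)` up to a factor, hence non-negative only for such `c₂`. With
`t = e^{-w/3}`, elementary bounds for `w`, `y`, `A` and `e` in terms of `t` compare all three terms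
with `(1 - t)²` times a function of `t`, and positivity becomes a polynomial inequality on `(0, 1)`
(`disc_polynomial_pos`, `phi_bounds`, `disc_pos`).
-/

namespace EERK

open Real

/-! ### The discriminant estimate -/

/-- The one-variable polynomial inequality to which the discriminant estimate reduces. -/
lemma disc_polynomial_pos {t : ℝ} (h0 : 0 < t) (h1 : t < 1) :
    ((t ^ 2 + 9 / 4 * t ^ 3) * (2 / 3 * t + t ^ 2 + 9 / 4 * t ^ 3) + (27 / 8 * t ^ 4 + t ^ 2))
        * (3 + 4 * t - 3 * t ^ 2)
      < 9 / 4 * ((1 + t + t ^ 2) ^ 2 * (1 + t ^ 3)) * (2 * t) := by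
  have hu : 0 < 1 - t := sub_pos.2 h1
  rw [← sub_pos]
  -- the difference has positive coefficients in the Bernstein basis of degree eight
  have key : 0 < 9/2 * t ^ 1 * (1 - t) ^ 7
      + 75/2 * t ^ 2 * (1 - t) ^ 6
      + 138 * t ^ 3 * (1 - t) ^ 5
      + 6749/24 * t ^ 4 * (1 - t) ^ 4
      + 1895/6 * t ^ 5 * (1 - t) ^ 3
      + 2723/16 * t ^ 6 * (1 - t) ^ 2
      + 563/24 * t ^ 7 * (1 - t) ^ 1
      + 151/12 * t ^ 8 * (1 - t) ^ 0 := by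
    positivity
  refine key.trans_eq ?_
  ring

/-- Elementary relations between `t = e^{-w/3}`, `y = φ₁(-w)` and `A = φ₁(-2w/3)`. -/
lemma phi_bounds {w t y A : ℝ} (hw : 0 < w) (ht0 : 0 < t) (ht1 : t < 1)
    (hy : w * y = 1 - t ^ 3) (hA : w * A = 3 / 2 * (1 - t ^ 2))
    (hy2 : y * (w + 2) ≤ 2) (hv1 : w * (2 * t) ≤ 3 * (1 - t ^ 2))
    (hv2 : 6 * (1 - t) ≤ w * (1 + t)) :
    0 < y ∧ y < A ∧ 2 / 3 * (1 - y) ≤ 1 - A ∧ 1 - y ≤ 3 / 2 * (1 - t) ∧ y < 1 := by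
  have hy0 : 0 < y := by
    have : 0 < w * y := by rw [hy]; nlinarith [pow_pos ht0 2]
    exact pos_of_mul_pos_right this hw.le
  have hy1 : y < 1 := by nlinarith
  have hyA : y < A := by
    have : 0 < w * (A - y) := by
      rw [mul_sub, hy, hA]
      nlinarith [mul_pos (sub_pos.2 ht1) (sub_pos.2 ht1)]
    linarith [pos_of_mul_pos_right this hw.le]
  have hA1 : 2 / 3 * (1 - y) ≤ 1 - A := by
    have : 0 ≤ w * (1 - A - 2 / 3 * (1 - y)) := by
      have h : w * (1 - A - 2 / 3 * (1 - y))
          = w / 3 - 3 / 2 * (1 - t ^ 2) + 2 / 3 * (1 - t ^ 3) := by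
        linear_combination -hA + 2 / 3 * hy
      rw [h]
      -- `hv2` reduces the claim to `(1 - t)³ (7 + 4 t) ≥ 0` up to a positive factor
      have h2 : 0 ≤ (1 + t) * (w / 3 - 3 / 2 * (1 - t ^ 2) + 2 / 3 * (1 - t ^ 3)) := by
        have : 0 ≤ (1 - t) ^ 3 * (7 + 4 * t) := by have := sub_pos.2 ht1; positivity
        nlinarith
      exact nonneg_of_mul_nonneg_right h2 (by linarith)
    linarith [nonneg_of_mul_nonneg_right this hw]
  have hyt : 1 - y ≤ 3 / 2 * (1 - t) := by
    by_contra! h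
    have h3 : 0 < 3 * t - 1 := by linarith
    have : 0 ≤ (1 - t) ^ 2 * (4 * t + 3) := by positivity
    nlinarith [mul_lt_mul_of_pos_left h (mul_pos hw ht0)]
  exact ⟨hy0, hyA, hA1, hyt, hy1⟩

/-- The discriminant estimate. With `r = (3y - 1) / 2`, `T = t³ = e^{-w}`, `a = t² = e^{-2w/3}`,
`e = e^{-cw}` and `b = 2(1 - A) / (3c)` the claim reads
`(a - rT)(e - rT) + (a - e)² (1 - r²) / (2b) < (1 - T²)(1 - r² - b/2)`.
Every term is compared with `(1 - t)²` times a function of `t`; the hypothesis `he3` records the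
sign of `a - e`, which the abscissa `c = 2/3` separates. -/
lemma disc_pos {w t y A e c : ℝ} (ht0 : 0 < t) (ht1 : t < 1)
    (hc₀ : 4 / 9 ≤ c) (hc₁ : c ≤ 1)
    (hy : w * y = 1 - t ^ 3)
    (hy2 : y * (w + 2) ≤ 2) (hv1 : w * (2 * t) ≤ 3 * (1 - t ^ 2))
    (hy0 : 0 < y) (hyA : y < A) (hA1 : 2 / 3 * (1 - y) ≤ 1 - A) (hyt : 1 - y ≤ 3 / 2 * (1 - t))
    (hy1 : y < 1) (he1 : t ^ 3 ≤ e) (he2 : e ≤ (2 * t + t ^ 2) / 3)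
    (he3 : c ≤ 2 / 3 ∧ t ^ 2 ≤ e ∨ e ≤ t ^ 2) :
    0 < (1 - (t ^ 3) ^ 2) * (3 / 4 * ((1 - y) * (1 + 3 * y)) - (1 - A) / (3 * c))
      - (t ^ 2 - (3 * y - 1) / 2 * t ^ 3) * (e - (3 * y - 1) / 2 * t ^ 3)
      - (t ^ 2 - e) ^ 2 * (3 / 4 * ((1 - y) * (1 + 3 * y))) * (3 * c / (4 * (1 - A))) := by
  have hA2 : A < 1 := by linarith
  have hc0 : 0 < c := by linarith
  have hu0 : 0 < 1 - t := by linarith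
  have h3 : 0 ≤ 1 - (t ^ 3) ^ 2 := by
    rw [← pow_mul, sub_nonneg]
    exact pow_le_one₀ ht0.le ht1.le
  -- `b / 2` is largest for `c = 4/9`
  have hb : (1 - A) / (3 * c) ≤ 3 / 4 * (1 - A) := by
    rw [div_le_iff₀ (by positivity)]
    nlinarith
  have e1 : 9 / 4 * (y * (1 - y)) ≤ 3 / 4 * ((1 - y) * (1 + 3 * y)) - (1 - A) / (3 * c) := by
    nlinarith
  have hK : 0 < 3 + 4 * t - 3 * t ^ 2 := by nlinarith
  have e2 : (1 - t) ^ 2 * ((1 + t + t ^ 2) ^ 2 * (1 + t ^ 3)) * (2 * t) ≤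
      (1 - (t ^ 3) ^ 2) * (y * (1 - y)) * (3 + 4 * t - 3 * t ^ 2) := by
    -- this is `1 - y ≥ w / (w + 2)` multiplied by `w * y = 1 - t³`
    have h1 : 1 - t ^ 3 ≤ (1 - y) * y * (w + 2) := by nlinarith
    -- `w + 2 ≤ (3 + 4t - 3t²) / (2t)` by `hv1`
    have h2 : (1 - t ^ 3) * (2 * t) ≤ (1 - y) * y * (3 + 4 * t - 3 * t ^ 2) := by
      have : 0 < (1 - y) * y := mul_pos (by linarith) hy0
      nlinarith
    have := mul_le_mul_of_nonneg_left h2 h3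
    calc _ = (1 - (t ^ 3) ^ 2) * ((1 - t ^ 3) * (2 * t)) := by ring
      _ ≤ _ := this
      _ = _ := by ring
  have e3 : (t ^ 2 - (3 * y - 1) / 2 * t ^ 3) * (e - (3 * y - 1) / 2 * t ^ 3) ≤
      ((1 - t) * (t ^ 2 + 9 / 4 * t ^ 3)) * ((1 - t) * (2 / 3 * t + t ^ 2 + 9 / 4 * t ^ 3)) := by
    have hT : 0 < t ^ 3 := by positivity
    have h1 : (1 - y) * t ^ 3 ≤ 3 / 2 * (1 - t) * t ^ 3 := by gcongr
    have h2 : 0 < (1 - y) * t ^ 3 := mul_pos (by linarith) hT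
    apply mul_le_mul
    · linarith
    · linarith
    · linarith
    · positivity
  have e4 : (t ^ 2 - e) ^ 2 * (3 / 4 * ((1 - y) * (1 + 3 * y))) * (3 * c / (4 * (1 - A))) ≤
      (1 - t) ^ 2 * (27 / 8 * t ^ 4 + t ^ 2) := by
    have h1 : (1 - y) * (3 * c / (4 * (1 - A))) ≤ 9 / 8 * c := by
      rw [mul_div_assoc', div_le_iff₀ (by linarith)]
      nlinarith
    have h2 : c * (t ^ 2 - e) ^ 2 ≤ (1 - t) ^ 2 * (t ^ 4 + 8 / 27 * t ^ 2) := by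
      rcases he3 with ⟨h, h'⟩ | h
      · have : (e - t ^ 2) ^ 2 ≤ (2 / 3 * ((1 - t) * t)) ^ 2 := by
          apply pow_le_pow_left₀ (by linarith)
          linarith
        have h5 : 0 ≤ (1 - t) ^ 2 * t ^ 4 := by positivity
        calc c * (t ^ 2 - e) ^ 2 = c * (e - t ^ 2) ^ 2 := by ring
          _ ≤ 2 / 3 * (2 / 3 * ((1 - t) * t)) ^ 2 := by gcongr
          _ ≤ _ := by nlinarith
      · have : (t ^ 2 - e) ^ 2 ≤ ((1 - t) * t ^ 2) ^ 2 := by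
          apply pow_le_pow_left₀ (by linarith)
          linarith
        have h5 : 0 ≤ (1 - t) ^ 2 * t ^ 2 := by positivity
        calc c * (t ^ 2 - e) ^ 2 ≤ 1 * ((1 - t) * t ^ 2) ^ 2 := by gcongr
          _ ≤ _ := by nlinarith
    have h3 : 0 ≤ (t ^ 2 - e) ^ 2 * (3 / 4 * (1 + 3 * y)) := by positivity
    calc _ = (t ^ 2 - e) ^ 2 * (3 / 4 * (1 + 3 * y))
          * ((1 - y) * (3 * c / (4 * (1 - A)))) := by ring
      _ ≤ (t ^ 2 - e) ^ 2 * (3 / 4 * (1 + 3 * y)) * (9 / 8 * c) := by gcongr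
      _ = c * (t ^ 2 - e) ^ 2 * (27 / 32 * (1 + 3 * y)) := by ring
      _ ≤ (1 - t) ^ 2 * (t ^ 4 + 8 / 27 * t ^ 2) * (27 / 32 * (1 + 3 * 1)) := by gcongr
      _ = _ := by ring
  have e5 : ((1 - t) * (t ^ 2 + 9 / 4 * t ^ 3))
        * ((1 - t) * (2 / 3 * t + t ^ 2 + 9 / 4 * t ^ 3))
      + (1 - t) ^ 2 * (27 / 8 * t ^ 4 + t ^ 2) < 9 / 4 * ((1 - (t ^ 3) ^ 2) * (y * (1 - y))) := by
    refine lt_of_mul_lt_mul_right ?_ hK.le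
    have := mul_lt_mul_of_pos_left (disc_polynomial_pos ht0 ht1) (pow_pos hu0 2)
    linarith
  have e6 := mul_le_mul_of_nonneg_left e1 h3
  linarith

/-! ### Reduction of the ternary form -/

/-- Positivity criterion for the form `⟨y, a̲ y⟩ - ½ (a₄₁ y₁ + a₄₂ y₂ + a₄₃ y₃)²` with the
(scaled) coefficients `a₂₁ = 1 - e`, `a₃₂ = b`, `a₃₁ = 1 - a - b`, `a₄₃ = 1 - r`, `a₄₂ = 0` and
`a₄₁ = r - T`. As `a₄₂ = 0`, the variable `y₂` is eliminated by completing a square with the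
leading coefficient `b`; the remaining binary form in `y₁, y₃` has the coefficient `hR` at `y₃²`,
and four times its determinant is the quantity `hΔ` divided by `b`. -/
lemma quadForm_pos {r T a e b : ℝ} (hb : 0 < b) (hR : 0 < (1 - r ^ 2) / 2 - b / 4)
    (hΔ : 0 < b * ((1 - T ^ 2) * (1 - r ^ 2 - b / 2) - (a - r * T) * (e - r * T))
      - (a - e) ^ 2 * (1 - r ^ 2) / 2) {y₁ y₂ y₃ : ℝ} (hne : ¬ (y₁ = 0 ∧ y₂ = 0 ∧ y₃ = 0)) :
    0 < (1 - e) * y₁ ^ 2 + b * y₂ ^ 2 + (1 - r) * y₃ ^ 2 + (e - a - b) * y₁ * y₂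
      + (r - T - (1 - a) + b) * y₁ * y₃ - b * y₂ * y₃
      - 1 / 2 * ((r - T) * y₁ + (1 - r) * y₃) ^ 2 := by
  set R := (1 - r ^ 2) / 2 - b / 4 with hRdef
  set Δ := b * ((1 - T ^ 2) * (1 - r ^ 2 - b / 2) - (a - r * T) * (e - r * T))
      - (a - e) ^ 2 * (1 - r ^ 2) / 2 with hΔdef
  set S := r * (r - T) - (2 - a - e) / 2 + b / 2 with hSdef
  -- `4 b R` times the form, as a sum of three squares with positive weights
  suffices h : 0 < R * (2 * b * y₂ + (e - a - b) * y₁ - b * y₃) ^ 2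
      + b * (2 * R * y₃ + S * y₁) ^ 2 + Δ * y₁ ^ 2 by
    refine pos_of_mul_pos_right (a := 4 * b * R) (h.trans_eq ?_) (by positivity)
    rw [hRdef, hΔdef, hSdef]
    ring
  by_cases h1 : y₁ = 0
  · by_cases h3 : y₃ = 0
    · have h2 : y₂ ≠ 0 := fun h2 => hne ⟨h1, h2, h3⟩
      subst h1 h3
      have : 0 < R * (2 * b * y₂) ^ 2 := by positivity
      simpa using this
    · subst h1
      have : 0 < b * (2 * R * y₃) ^ 2 := by positivity
      have h4 : 0 ≤ R * (2 * b * y₂ - b * y₃) ^ 2 := by positivity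
      simp only [mul_zero, add_zero]
      linarith
  · have : 0 < Δ * y₁ ^ 2 := by positivity
    have h4 : 0 ≤ R * (2 * b * y₂ + (e - a - b) * y₁ - b * y₃) ^ 2 := by positivity
    have h5 : 0 ≤ b * (2 * R * y₃ + S * y₁) ^ 2 := by positivity
    linarith

/-- The quadratic form of the (scaled) differentiation matrix: the substitution `x = a̲ y`, which
inverts the convolution kernels, turns it into the form of `quadForm_pos`. -/
lemma scaledForm_pos {r T a e b : ℝ} (hs : 0 < 1 - e) (hf : 0 < 1 - r) (hb : 0 < b)
    (hR : 0 < (1 - r ^ 2) / 2 - b / 4)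
    (hΔ : 0 < b * ((1 - T ^ 2) * (1 - r ^ 2 - b / 2) - (a - r * T) * (e - r * T))
      - (a - e) ^ 2 * (1 - r ^ 2) / 2) {x₁ x₂ x₃ : ℝ} (hne : ¬ (x₁ = 0 ∧ x₂ = 0 ∧ x₃ = 0)) :
    0 < (1 / (1 - e) - 1 / 2) * x₁ * x₁
      + ((1 / b + 1 / (1 - e) - (1 - a) / (b * (1 - e)) - 1) * x₁ + (1 / b - 1 / 2) * x₂) * x₂
      + (((T - e + (1 - r)) / ((1 - e) * (1 - r)) - 1) * x₁ + (1 / (1 - r) - 1) * x₂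
        + (1 / (1 - r) - 1 / 2) * x₃) * x₃ := by
  obtain ⟨y₁, rfl⟩ : ∃ y, x₁ = (1 - e) * y := ⟨x₁ / (1 - e), by field_simp⟩
  obtain ⟨y₂, rfl⟩ : ∃ y, x₂ = (e - a - b) * y₁ + b * y :=
    ⟨(x₂ - (e - a - b) * y₁) / b, by field_simp; ring⟩
  obtain ⟨y₃, rfl⟩ : ∃ y, x₃ = (r - T - (1 - a) + b) * y₁ - b * y₂ + (1 - r) * y :=
    ⟨(x₃ - (r - T - (1 - a) + b) * y₁ + b * y₂) / (1 - r), by field_simp; ring⟩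
  refine (quadForm_pos hb hR hΔ (y₁ := y₁) (y₂ := y₂) (y₃ := y₃) ?_).trans_eq ?_
  · rintro ⟨rfl, rfl, rfl⟩
    exact hne (by simp)
  · field_simp
    ring

/-- The quadratic form of the differentiation matrix at `z = -w` is positive, in terms of
`t = e^{-w/3}`, `y = φ₁(-w)`, `A = φ₁(-2w/3)`, `e = e^{-cw}` and the coefficients `q = a₂₁(z)`,
`b = a₃₂(z)`, `f = a₄₃(z)`. The factor `w` scales the form to that of `scaledForm_pos`. -/
lemma diffForm_pos {w t y A e c q b f x₁ x₂ x₃ : ℝ} (hw : 0 < w) (ht0 : 0 < t) (ht1 : t < 1)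
    (hc₀ : 4 / 9 ≤ c) (hc₁ : c ≤ 1) (hs0 : 0 < 1 - e)
    (hy : w * y = 1 - t ^ 3) (hA : w * A = 3 / 2 * (1 - t ^ 2))
    (hy2 : y * (w + 2) ≤ 2) (hv1 : w * (2 * t) ≤ 3 * (1 - t ^ 2))
    (hv2 : 2 * (1 - t) ≤ w / 3 * (1 + t)) (he1 : t ^ 3 ≤ e) (he2 : e ≤ (2 * t + t ^ 2) / 3)
    (he3 : c ≤ 2 / 3 ∧ t ^ 2 ≤ e ∨ e ≤ t ^ 2) (hq : q = (1 - e) / w)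
    (hb₀ : b = 4 / (9 * c) * (3 * (1 - A) / (2 * w))) (hf : f = 3 / 2 * ((1 - y) / w))
    (hne : ¬ (x₁ = 0 ∧ x₂ = 0 ∧ x₃ = 0)) :
    0 < (1 / q + -w / 2) * x₁ * x₁
      + ((-((2 / 3 * A - b - q) / (b * q)) + -w) * x₁ + (1 / b + -w / 2) * x₂) * x₂
      + ((((0 - b) / (f * b) * (2 / 3 * A - b - q) - (y - f - (2 / 3 * A - b)) / f) / q + -w) * x₁
        + (-((0 - b) / (f * b)) + -w) * x₂ + (1 / f + -w / 2) * x₃) * x₃ := by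
  subst hq hb₀ hf
  have hc : 0 < c := by linarith
  obtain ⟨hy0, hyA, hA1, hyt, hy1⟩ := phi_bounds hw ht0 ht1 hy hA hy2 hv1 (by linarith)
  have hdisc := disc_pos ht0 ht1 hc₀ hc₁ hy hy2 hv1 hy0 hyA hA1 hyt hy1 he1 he2 he3
  have hA2 : 0 < 1 - A := by linarith
  have hy3 : 0 < 1 - y := by linarith
  have hb : 0 < 2 * (1 - A) / (3 * c) := by positivity
  have hb' : (1 - A) / (3 * c) ≤ 3 / 4 * (1 - A) := by
    rw [div_le_iff₀ (by positivity)]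
    nlinarith
  have h := scaledForm_pos (r := (3 * y - 1) / 2) (T := t ^ 3) (a := t ^ 2) (e := e)
    (b := 2 * (1 - A) / (3 * c)) hs0 (by linarith) hb
    (by
      have : 2 * (1 - A) / (3 * c) / 4 = (1 - A) / (3 * c) / 2 := by ring
      rw [this]
      nlinarith [mul_pos hy0 hy3])
    ((mul_pos hb hdisc).trans_eq (by field_simp; ring)) hne
  rw [show 1 - (3 * y - 1) / 2 = 3 / 2 * (1 - y) by ring] at h
  refine (mul_pos hw h).trans_eq ?_
  rw [show t ^ 2 = 1 - 2 / 3 * (w * A) by linarith, show t ^ 3 = 1 - w * y by linarith]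
  field_simp
  ring

/-! ### The functions `φ₁` and `φ₂` and bounds for the exponential -/

lemma phi_one_eq {z : ℝ} (hz : z ≠ 0) : phi 1 z = (exp z - 1) / z := by
  have h : ∀ s ∈ Set.uIcc (0 : ℝ) 1,
      HasDerivAt (fun s => -(exp ((1 - s) * z) / z))
        (exp ((1 - s) * z) * (s ^ 0 / (Nat.factorial 0 : ℝ))) s := by
    intro s _
    have h1 : HasDerivAt (fun s : ℝ => (1 - s) * z) (-1 * z) s :=
      ((hasDerivAt_id s).const_sub 1).mul_const z
    refine (h1.exp.div_const z).neg.congr_deriv ?_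
    simp; field_simp
  rw [phi, intervalIntegral.integral_eq_sub_of_hasDerivAt h
    (by apply Continuous.intervalIntegrable; fun_prop)]
  simp; ring

lemma phi_two_eq {z : ℝ} (hz : z ≠ 0) : phi 2 z = (phi 1 z - 1) / z := by
  have h : ∀ s ∈ Set.uIcc (0 : ℝ) 1,
      HasDerivAt (fun s => -(s * exp ((1 - s) * z) / z) - exp ((1 - s) * z) / z ^ 2)
        (exp ((1 - s) * z) * (s ^ 1 / (Nat.factorial 1 : ℝ))) s := by
    intro s _
    have h1 : HasDerivAt (fun s : ℝ => (1 - s) * z) (-1 * z) s :=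
      ((hasDerivAt_id s).const_sub 1).mul_const z
    refine ((((hasDerivAt_id s).mul h1.exp).div_const z).neg.sub
      (h1.exp.div_const (z ^ 2))).congr_deriv ?_
    simp; field_simp; ring
  rw [phi, intervalIntegral.integral_eq_sub_of_hasDerivAt h
    (by apply Continuous.intervalIntegrable; fun_prop), phi_one_eq hz]
  simp; field_simp; ring

lemma phi_one_pos {z : ℝ} (hz : z < 0) : 0 < phi 1 z := by
  rw [phi_one_eq hz.ne]
  exact div_pos_of_neg_of_neg (by simpa using hz) hz

lemma phi_one_lt_one {z : ℝ} (hz : z < 0) : phi 1 z < 1 := by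
  rw [phi_one_eq hz.ne, div_lt_one_of_neg hz]
  linarith [Real.add_one_lt_exp hz.ne]

lemma phi_two_pos {z : ℝ} (hz : z < 0) : 0 < phi 2 z := by
  rw [phi_two_eq hz.ne]
  exact div_pos_of_neg_of_neg (by linarith [phi_one_lt_one hz]) hz

/-- The bound `v ≤ sinh v` for `v = w / 3`, written in terms of `e^{-w/3}`. -/
lemma exp_neg_third {w : ℝ} (hw : 0 < w) :
    w * (2 * exp (-w / 3)) ≤ 3 * (1 - exp (-w / 3) ^ 2) := by
  have h := Real.self_le_sinh_iff.2 (show 0 ≤ w / 3 by positivity)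
  rw [Real.sinh_eq] at h
  have h1 : exp (-(w / 3)) = exp (-w / 3) := by ring_nf
  have h2 : exp (w / 3) * exp (-w / 3) = 1 := by rw [← Real.exp_add]; ring_nf; simp
  rw [h1] at h
  nlinarith [mul_le_mul_of_nonneg_right h (Real.exp_pos (-w / 3)).le]

/-- The Padé bound `x ≥ 2 tanh (x / 2)`. -/
lemma two_mul_one_sub_exp_neg_le {x : ℝ} (hx : 0 < x) :
    2 * (1 - exp (-x)) ≤ x * (1 + exp (-x)) := by
  have h := Real.le_log_one_add_of_nonneg (x := exp x - 1) (by linarith [Real.one_le_exp hx.le])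
  have h0 := Real.exp_pos x
  rw [add_sub_cancel, Real.log_exp, div_le_iff₀ (by linarith)] at h
  rw [Real.exp_neg]
  field_simp
  linarith

/-! ### The differentiation matrix -/

lemma docKernel_self (a : ℕ → ℕ → ℝ → ℝ) (k : ℕ) (z : ℝ) :
    docKernel a k k z = 1 / diffCoeff a (k + 1) k z := by
  rw [docKernel, if_pos le_rfl]

lemma docKernel_of_lt (a : ℕ → ℕ → ℝ → ℝ) {k j : ℕ} (h : j < k) (z : ℝ) :
    docKernel a k j z = -∑ l ∈ Finset.Icc (j + 1) k,
      docKernel a k l z * (diffCoeff a (l + 1) j z / diffCoeff a (j + 1) j z) := by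
  rw [docKernel, if_neg (by omega), ← Finset.sum_coe_sort (Finset.Icc (j + 1) k)]

lemma dEntry_self (a : ℕ → ℕ → ℝ → ℝ) (z : ℝ) (k : ℕ) :
    dEntry a k k z = 1 / a (k + 1) k z + z / 2 := by
  simp [dEntry, docKernel_self, diffCoeff]; ring

lemma dEntry_of_lt (a : ℕ → ℕ → ℝ → ℝ) (z : ℝ) {k l : ℕ} (h : k < l) :
    dEntry a k l z = 0 := by
  simp [dEntry, h]

lemma docKernel_succ (a : ℕ → ℕ → ℝ → ℝ) (z : ℝ) (k : ℕ) :
    docKernel a (k + 1) k z =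
    -((a (k + 2) k z - a (k + 1) k z) / (a (k + 2) (k + 1) z * a (k + 1) k z)) := by
  simp [docKernel_of_lt, docKernel_self, diffCoeff]; ring

lemma dEntry_succ (a : ℕ → ℕ → ℝ → ℝ) (z : ℝ) (k : ℕ) :
    dEntry a (k + 1) k z =
    -((a (k + 2) k z - a (k + 1) k z) / (a (k + 2) (k + 1) z * a (k + 1) k z)) + z := by
  simp [dEntry, docKernel_succ]

lemma dEntry_three_one (a : ℕ → ℕ → ℝ → ℝ) (z : ℝ) : dEntry a 3 1 z =
    ((a 4 2 z - a 3 2 z) / (a 4 3 z * a 3 2 z) * (a 3 1 z - a 2 1 z)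
      - (a 4 1 z - a 3 1 z) / a 4 3 z) / a 2 1 z + z := by
  have h : Finset.Icc 2 3 = {2, 3} := rfl
  simp [dEntry, docKernel_of_lt, h, docKernel_self, diffCoeff]; ring

theorem diffMatrix_eerk31 {c₂ : ℝ} (hc : 0 < c₂) {z : ℝ} (hz : z < 0) :
    diffMatrix (eerk31 c₂) 3 z =
        !![1 / (c₂ * phi 1 (c₂ * z)) + z / 2, 0, 0;
          9 * c₂ / (4 * phi 2 (2 / 3 * z)) + 1 / (c₂ * phi 1 (c₂ * z))
              - 3 * phi 1 (2 / 3 * z)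
                / (2 * phi 2 (2 / 3 * z) * phi 1 (c₂ * z)) + z,
            9 * c₂ / (4 * phi 2 (2 / 3 * z)) + z / 2, 0;
          (2 * c₂ * phi 1 (c₂ * z) - 2 * phi 1 z + 3 * phi 2 z)
              / (3 * c₂ * phi 1 (c₂ * z) * phi 2 z) + z,
            2 / (3 * phi 2 z) + z, 2 / (3 * phi 2 z) + z / 2] := by
  have h1 := phi_one_pos (mul_neg_of_pos_of_neg hc hz)
  have h2 := phi_two_pos (show 2 / 3 * z < 0 by linarith)
  have h3 := phi_two_pos hz
  ext k l
  fin_cases k <;> fin_cases l <;>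
    simp [diffMatrix, dEntry_self, dEntry_of_lt, dEntry_succ, dEntry_three_one, eerk31] <;>
    generalize phi 2 (2 / 3 * z) = p at * <;> generalize phi 1 (2 / 3 * z) = q at * <;>
    field_simp <;> ring

lemma eerk31_ne_zero {c₂ : ℝ} (hc : 0 < c₂) (z : ℝ) (hz : z < 0) :
    eerk31 c₂ 2 1 z ≠ 0 ∧ eerk31 c₂ 3 2 z ≠ 0 ∧ eerk31 c₂ 4 3 z ≠ 0 := by
  have h1 := phi_one_pos (mul_neg_of_pos_of_neg hc hz)
  have h2 := phi_two_pos (show 2 / 3 * z < 0 by linarith)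
  have h3 := phi_two_pos hz
  simp only [eerk31]
  exact ⟨by positivity, by positivity, by positivity⟩

/-- The quadratic form of the differentiation matrix of the method is positive at every `z < 0`. -/
theorem dEntry_form_pos {c₂ : ℝ} (hc₂ : c₂ ∈ Set.Icc (4 / 9 : ℝ) 1) {z : ℝ} (hz : z < 0)
    {x₁ x₂ x₃ : ℝ} (hne : ¬ (x₁ = 0 ∧ x₂ = 0 ∧ x₃ = 0)) :
    0 < dEntry (eerk31 c₂) 1 1 z * x₁ * x₁
      + (dEntry (eerk31 c₂) 2 1 z * x₁ + dEntry (eerk31 c₂) 2 2 z * x₂) * x₂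
      + (dEntry (eerk31 c₂) 3 1 z * x₁ + dEntry (eerk31 c₂) 3 2 z * x₂
        + dEntry (eerk31 c₂) 3 3 z * x₃) * x₃ := by
  obtain ⟨hc₀, hc₁⟩ := hc₂
  obtain ⟨w, rfl⟩ : ∃ w, z = -w := ⟨-z, by simp⟩
  have hw : 0 < w := by linarith
  have hc : 0 < c₂ := by linarith
  have hT : exp (-w) = exp (-w / 3) ^ 3 := by rw [← Real.exp_nat_mul]; congr 1; push_cast; ring
  have ha : exp (2 / 3 * -w) = exp (-w / 3) ^ 2 := by
    rw [← Real.exp_nat_mul]; congr 1; push_cast; ring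
  have ht0 := Real.exp_pos (-w / 3)
  have ht1 : exp (-w / 3) < 1 := by rw [Real.exp_lt_one_iff]; linarith
  have hv1 := exp_neg_third hw
  have hv2 := two_mul_one_sub_exp_neg_le (show 0 < w / 3 by positivity)
  have hT2 := two_mul_one_sub_exp_neg_le hw
  rw [show -(w / 3) = -w / 3 by ring] at hv2
  have hy : w * phi 1 (-w) = 1 - exp (-w / 3) ^ 3 := by
    rw [phi_one_eq hz.ne, hT]; field_simp; ring
  have hA : w * phi 1 (2 / 3 * -w) = 3 / 2 * (1 - exp (-w / 3) ^ 2) := by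
    rw [phi_one_eq (by linarith), ha]; field_simp; ring
  have hs : c₂ * phi 1 (c₂ * -w) = (1 - exp (c₂ * -w)) / w := by
    rw [phi_one_eq (mul_neg_of_pos_of_neg hc hz).ne]; field_simp; ring
  have hB : phi 2 (2 / 3 * -w) = 3 * (1 - phi 1 (2 / 3 * -w)) / (2 * w) := by
    rw [phi_two_eq (by linarith)]; field_simp; ring
  have hf : phi 2 (-w) = (1 - phi 1 (-w)) / w := by
    rw [phi_two_eq hz.ne]; field_simp; ring
  have hs0 : 0 < 1 - exp (c₂ * -w) := by
    rw [sub_pos, Real.exp_lt_one_iff]; exact mul_neg_of_pos_of_neg hc hz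
  have hy2 : phi 1 (-w) * (w + 2) ≤ 2 := by
    rw [hT, show exp (-w / 3) ^ 3 = 1 - w * phi 1 (-w) by linarith] at hT2
    exact le_of_mul_le_mul_left (by linarith) hw
  have he1 : exp (-w / 3) ^ 3 ≤ exp (c₂ * -w) := by
    rw [← hT, Real.exp_le_exp]; nlinarith
  have he2 : exp (c₂ * -w) ≤ (2 * exp (-w / 3) + exp (-w / 3) ^ 2) / 3 := by
    -- weighted AM-GM for `e^{-4w/9} = (e^{-w/3})^{2/3} (e^{-2w/3})^{1/3}`
    have h := convexOn_exp.2 (Set.mem_univ (-w / 3)) (Set.mem_univ (2 / 3 * -w))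
      (show (0 : ℝ) ≤ 2 / 3 by norm_num) (show (0 : ℝ) ≤ 1 / 3 by norm_num) (by norm_num)
    rw [ha] at h
    simp only [smul_eq_mul] at h
    have h' : exp (c₂ * -w) ≤ exp (2 / 3 * (-w / 3) + 1 / 3 * (2 / 3 * -w)) :=
      Real.exp_le_exp.2 (by nlinarith)
    linarith
  have he3 : c₂ ≤ 2 / 3 ∧ exp (-w / 3) ^ 2 ≤ exp (c₂ * -w) ∨
      exp (c₂ * -w) ≤ exp (-w / 3) ^ 2 := by
    rw [← ha, Real.exp_le_exp, Real.exp_le_exp]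
    rcases le_total c₂ (2 / 3) with h | h
    · exact Or.inl ⟨h, by nlinarith⟩
    · exact Or.inr (by nlinarith)
  clear hT ha hT2
  have hd31 : dEntry (eerk31 c₂) 3 1 (-w) = _ := dEntry_three_one _ _
  have hd21 : dEntry (eerk31 c₂) 2 1 (-w) = _ := dEntry_succ _ _ 1
  have hd32 : dEntry (eerk31 c₂) 3 2 (-w) = _ := dEntry_succ _ _ 2
  rw [hd31, hd21, hd32, dEntry_self, dEntry_self, dEntry_self]
  simp only [eerk31, hs, hB, hf]
  generalize exp (c₂ * -w) = e at *
  generalize exp (-w / 3) = t at *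
  generalize phi 1 (-w) = y at *
  generalize phi 1 (2 / 3 * -w) = A at *
  exact diffForm_pos hw ht0 ht1 hc₀ hc₁ hs0 hy hA hy2 hv1 hv2 he1 he2 he3 rfl rfl rfl hne

theorem dEntry_form_nonneg {c₂ : ℝ} (hc₂ : c₂ ∈ Set.Icc (4 / 9 : ℝ) 1) (z : ℝ) (hz : z < 0)
    (x₁ x₂ x₃ : ℝ) :
    0 ≤ dEntry (eerk31 c₂) 1 1 z * x₁ * x₁
      + (dEntry (eerk31 c₂) 2 1 z * x₁ + dEntry (eerk31 c₂) 2 2 z * x₂) * x₂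
      + (dEntry (eerk31 c₂) 3 1 z * x₁ + dEntry (eerk31 c₂) 3 2 z * x₂
        + dEntry (eerk31 c₂) 3 3 z * x₃) * x₃ := by
  by_cases hne : x₁ = 0 ∧ x₂ = 0 ∧ x₃ = 0
  · obtain ⟨rfl, rfl, rfl⟩ := hne
    simp
  · exact (dEntry_form_pos hc₂ hz hne).le

theorem posDef_symPart {c₂ : ℝ} (hc₂ : c₂ ∈ Set.Icc (4 / 9 : ℝ) 1) {z : ℝ} (hz : z < 0) :
    (symPart (diffMatrix (eerk31 c₂) 3 z)).PosDef := by
  refine Matrix.PosDef.of_dotProduct_mulVec_pos ?_ fun x hx => ?_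
  · ext i j
    simp [symPart]
    ring
  · refine (dEntry_form_pos hc₂ hz (x₁ := x 0) (x₂ := x 1) (x₃ := x 2) ?_).trans_eq ?_
    · rintro ⟨h0, h1, h2⟩
      exact hx (by ext i; fin_cases i <;> simpa)
    · simp [symPart, diffMatrix, dotProduct, Matrix.mulVec, Fin.sum_univ_three, dEntry_of_lt]
      ring

/-! ### Matrix functions in an eigenbasis -/

lemma posDef_stabMatrix {ι : Type*} [DecidableEq ι] {L : Matrix ι ι ℝ} (hL : L.PosDef)
    {κ : ℝ} (hκ : 0 < κ) :
    (stabMatrix L κ).PosDef := hL.add (Matrix.PosDef.one.smul hκ)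

section Problem

variable {ι : Type*} [Fintype ι] [DecidableEq ι]

/-- In an eigenbasis of `A`, the matrix function `f(A)` acts diagonally. -/
lemma inner_matFun {A : Matrix ι ι ℝ} (hA : A.IsHermitian) (f : ℝ → ℝ) (i : ι)
    (v : EuclideanSpace ℝ ι) :
    inner ℝ (hA.eigenvectorBasis i) (matFun f A v)
      = f (hA.eigenvalues i) * inner ℝ (hA.eigenvectorBasis i) v := by
  have hM : (cfc f A).IsHermitian := cfc_predicate f A
  have hsym := Matrix.isSymmetric_toEuclideanLin_iff.mpr hM
  have hev : Matrix.toEuclideanLin (cfc f A) (hA.eigenvectorBasis i)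
      = f (hA.eigenvalues i) • hA.eigenvectorBasis i := by
    apply (WithLp.ofLp_injective 2)
    rw [hA.cfc_eq, Matrix.IsHermitian.cfc, Unitary.conjStarAlgAut_apply]
    simp only [Matrix.toLpLin_apply, ← Matrix.mulVec_mulVec]
    rw [Matrix.IsHermitian.star_eigenvectorUnitary_mulVec]
    simp
  rw [matFun, ← hsym, hev, real_inner_smul_left]

lemma inner_toEuclideanLin {A : Matrix ι ι ℝ} (hA : A.IsHermitian) (i : ι)
    (v : EuclideanSpace ℝ ι) :
    inner ℝ (hA.eigenvectorBasis i) (Matrix.toEuclideanLin A v)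
      = hA.eigenvalues i * inner ℝ (hA.eigenvectorBasis i) v := by
  have h := inner_matFun hA id i v
  rwa [matFun, show cfc id A = A from cfc_id ℝ A hA] at h

lemma eigenvalues_neg_smul {τ : ℝ} (hτ : 0 < τ) {K : Matrix ι ι ℝ} (hK : K.PosDef)
    (hA : (-τ • K).IsHermitian) (i : ι) : hA.eigenvalues i < 0 := by
  have h := inner_toEuclideanLin hA i (hA.eigenvectorBasis i)
  have h0 : hA.eigenvectorBasis i ≠ 0 := (hA.eigenvectorBasis.orthonormal.ne_zero i)
  have h2 := hK.dotProduct_mulVec_pos (x := WithLp.ofLp (hA.eigenvectorBasis i)) (by simpa using h0)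
  rw [real_inner_self_eq_norm_sq, hA.eigenvectorBasis.orthonormal.1 i] at h
  generalize hA.eigenvectorBasis i = e at *
  generalize hA.eigenvalues i = μ at *
  simp [Matrix.toLpLin_apply, EuclideanSpace.inner_eq_star_dotProduct] at h
  rw [star_trivial, dotProduct_comm] at h2
  rw [← h, neg_lt_zero]
  exact mul_pos hτ h2

/-! ### The differential form of the method and its dissipation -/

/-- Applying the difference kernels to the stages of a scalar problem recovers the differential form
of the method: the convolution kernels `θ` invert the difference coefficients, and the terms
`z (2 - δ_{kℓ}) / 2` sum up to the midpoint `(p k + p (k + 1)) / 2 - p 1`. -/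
lemma sum_dEntry_mul_sub {a : ℕ → ℕ → ℝ → ℝ} {z : ℝ} (h₁ : a 2 1 z ≠ 0) (h₂ : a 3 2 z ≠ 0)
    (h₃ : a 4 3 z ≠ 0) {p γ : ℕ → ℝ}
    (hp : ∀ i ∈ Finset.Icc 1 3, p (i + 1) = p 1 + ∑ j ∈ Finset.Icc 1 i, a (i + 1) j z * γ j)
    {k : ℕ} (hk : k ∈ Finset.Icc 1 3) :
    ∑ l ∈ Finset.Icc 1 k, dEntry a k l z * (p (l + 1) - p l)
      = γ k + z * ((p k + p (k + 1)) / 2 - p 1) := by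
  have p2 := hp 1 (by simp)
  have p3 := hp 2 (by simp)
  have p4 := hp 3 (by simp)
  have d21 : dEntry a 2 1 z = _ := dEntry_succ a z 1
  have d32 : dEntry a 3 2 z = _ := dEntry_succ a z 2
  simp [Finset.sum_Icc_succ_top] at p2 p3 p4
  obtain ⟨hk1, hk3⟩ := Finset.mem_Icc.1 hk
  interval_cases k <;>
    simp [Finset.sum_Icc_succ_top, dEntry_self, d21, d32, dEntry_three_one, p2, p3, p4] <;>
    field_simp <;> ring

/-- Differential form of the method, obtained from `sum_dEntry_mul_sub` in the coordinates of an
eigenbasis of `-τ L_κ`. -/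
lemma sum_matFun_dEntry {a : ℕ → ℕ → ℝ → ℝ} {L : Matrix ι ι ℝ} (hL : L.PosDef)
    {κ τ : ℝ} (hκ : 0 < κ) (hτ : 0 < τ)
    (ha : ∀ z < 0, a 2 1 z ≠ 0 ∧ a 3 2 z ≠ 0 ∧ a 4 3 z ≠ 0)
    {g : EuclideanSpace ℝ ι → EuclideanSpace ℝ ι} {U : ℕ → EuclideanSpace ℝ ι}
    (hU : IsStep a 3 L g κ τ U) {k : ℕ} (hk : k ∈ Finset.Icc 1 3) :
    ∑ l ∈ Finset.Icc 1 k, matFun (dEntry a k l) (-τ • stabMatrix L κ) (U (l + 1) - U l)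
      = τ • stabNonlin g κ (U k)
        - (τ / 2) • Matrix.toEuclideanLin (stabMatrix L κ) (U k + U (k + 1)) := by
  have hK := posDef_stabMatrix hL hκ
  have hA : (-τ • stabMatrix L κ).IsHermitian := hK.1.smul (IsSelfAdjoint.all _)
  apply hA.eigenvectorBasis.repr.injective
  ext i
  rw [hA.eigenvectorBasis.repr_apply_apply, hA.eigenvectorBasis.repr_apply_apply]
  have hz := eigenvalues_neg_smul hτ hK hA i
  have hlin : ∀ v, τ * inner ℝ (hA.eigenvectorBasis i) (Matrix.toEuclideanLin (stabMatrix L κ) v)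
      = -(hA.eigenvalues i * inner ℝ (hA.eigenvectorBasis i) v) := by
    intro v
    rw [← inner_toEuclideanLin]
    simp [inner_smul_right]
  obtain ⟨h₁, h₂, h₃⟩ := ha _ hz
  have := sum_dEntry_mul_sub h₁ h₂ h₃ (p := fun k => inner ℝ (hA.eigenvectorBasis i) (U k))
    (γ := fun k => τ * inner ℝ (hA.eigenvectorBasis i) (stabNonlin g κ (U k))
      + hA.eigenvalues i * inner ℝ (hA.eigenvectorBasis i) (U 1)) (fun m hm => ?_) hk
  · simp only [inner_sum, inner_matFun, inner_sub_right, inner_smul_right, map_add,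
      inner_add_right] at this ⊢
    rw [this]
    have l1 := hlin (U k)
    have l2 := hlin (U (k + 1))
    linear_combination l1 / 2 + l2 / 2
  · rw [hU m hm]
    simp only [inner_add_right, inner_sum, inner_matFun, inner_sub_right, inner_smul_right, hlin,
      sub_neg_eq_add]

/-- In an eigenbasis of `-τ L_κ` the dissipation splits into the quadratic forms of the
differentiation matrix at the (negative) eigenvalues. For `j < 3` the form is evaluated at
vectors whose last entries vanish. -/
lemma dissipation_nonneg {a : ℕ → ℕ → ℝ → ℝ} {L : Matrix ι ι ℝ} (hL : L.PosDef)
    {κ τ : ℝ} (hκ : 0 < κ) (hτ : 0 < τ)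
    (ha : ∀ z < 0, ∀ x₁ x₂ x₃ : ℝ, 0 ≤ dEntry a 1 1 z * x₁ * x₁
      + (dEntry a 2 1 z * x₁ + dEntry a 2 2 z * x₂) * x₂
      + (dEntry a 3 1 z * x₁ + dEntry a 3 2 z * x₂ + dEntry a 3 3 z * x₃) * x₃)
    (U : ℕ → EuclideanSpace ℝ ι) {j : ℕ} (hj : j ∈ Finset.Icc 1 3) :
    0 ≤ dissipation a L κ τ U j := by
  have hK := posDef_stabMatrix hL hκ
  have hA : (-τ • stabMatrix L κ).IsHermitian := hK.1.smul (IsSelfAdjoint.all _)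
  rw [dissipation]
  rw [Finset.sum_congr rfl fun k _ => (hA.eigenvectorBasis.sum_inner_mul_inner _ _).symm,
    Finset.sum_comm]
  simp only [inner_sum, inner_matFun]
  refine Finset.sum_nonneg fun i _ => ?_
  have h := ha _ (eigenvalues_neg_smul hτ hK hA i)
  obtain ⟨hj1, hj3⟩ := Finset.mem_Icc.1 hj
  have hcomm : ∀ k, inner ℝ (U (k + 1) - U k) (hA.eigenvectorBasis i)
    = inner ℝ (hA.eigenvectorBasis i) (U (k + 1) - U k) := fun k => real_inner_comm _ _
  simp only [hcomm]
  generalize hx : (fun k => inner ℝ (hA.eigenvectorBasis i) (U (k + 1) - U k)) = x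
  have hx' : ∀ k, inner ℝ (hA.eigenvectorBasis i) (U (k + 1) - U k) = x k := congrFun hx
  simp only [hx']
  interval_cases j
  · refine (h (x 1) 0 0).trans_eq ?_
    simp
    ring
  · refine (h (x 1) (x 2) 0).trans_eq ?_
    simp [Finset.sum_Icc_succ_top]
    ring
  · refine (h (x 1) (x 2) (x 3)).trans_eq ?_
    simp [Finset.sum_Icc_succ_top]
    ring

/-! ### The energy dissipation law -/

/-- First-order expansion of a function with Lipschitz gradient `-g`. The mean value theorem gives
the constant `ℓ`; the sharp constant `ℓ / 2` is not needed because `κ ≥ 2ℓ`. -/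
lemma sub_le_of_hasGradientAt_neg {E : Type*} [NormedAddCommGroup E] [InnerProductSpace ℝ E]
    [CompleteSpace E] {F : E → ℝ} {g : E → E} (hF : ∀ v, HasGradientAt F (-(g v)) v)
    {ℓ : ℝ≥0} (hg : LipschitzWith ℓ g) (u v : E) :
    F v - F u ≤ -inner ℝ (g u) (v - u) + ℓ * ‖v - u‖ ^ 2 := by
  have hline : ∀ t : ℝ, HasDerivAt (fun t : ℝ => F (u + t • (v - u)))
      (-inner ℝ (g (u + t • (v - u))) (v - u)) t := by
    intro t
    have h1 : HasDerivAt (fun t : ℝ => u + t • (v - u)) (v - u) t := by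
      simpa using ((hasDerivAt_id t).smul_const (v - u)).const_add u
    have h2 := (hF (u + t • (v - u))).hasFDerivAt.comp_hasDerivAt t h1
    simpa [Function.comp_def] using h2
  obtain ⟨t, ht, h⟩ := exists_hasDerivAt_eq_slope _ _ zero_lt_one
    (fun t _ => (hline t).continuousAt.continuousWithinAt) (fun t _ => hline t)
  simp only [one_smul, zero_smul, add_zero, sub_zero, div_one, add_sub_cancel] at h
  rw [← h]
  have h3 : ‖g (u + t • (v - u)) - g u‖ ≤ ℓ * ‖v - u‖ := by
    have := hg.norm_sub_le (u + t • (v - u)) u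
    rw [add_sub_cancel_left, norm_smul, Real.norm_of_nonneg ht.1.le] at this
    refine this.trans ?_
    have := mul_le_of_le_one_left (norm_nonneg (v - u)) ht.2.le
    gcongr
  have h4 := (abs_le.1 (abs_real_inner_le_norm (g (u + t • (v - u)) - g u) (v - u))).1
  rw [inner_sub_left] at h4
  nlinarith [mul_le_mul_of_nonneg_right h3 (norm_nonneg (v - u))]

/-- Energy change between consecutive stages `u` and `v`: testing the stage equation with `v - u`
produces the quadratic part of the energy exactly, and the stabilization term `κ/2 ‖v - u‖²` absorbs
the remainder of the nonlinear part. -/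
lemma energy_sub_le {L : Matrix ι ι ℝ} (hL : L.PosDef)
    {g : EuclideanSpace ℝ ι → EuclideanSpace ℝ ι} {G : EuclideanSpace ℝ ι → ι → ℝ}
    (hG : ∀ v, HasGradientAt (fun w => ∑ i, G w i) (-(g v)) v)
    {ℓ : ℝ≥0} (hg : LipschitzWith ℓ g) {κ : ℝ} (hκ : 2 * (ℓ : ℝ) ≤ κ) {τ : ℝ} (hτ : 0 < τ)
    (u v : EuclideanSpace ℝ ι) :
    energy L G v - energy L G u ≤ -(1 / τ) * inner ℝ (v - u)
      (τ • stabNonlin g κ u - (τ / 2) • Matrix.toEuclideanLin (stabMatrix L κ) (u + v)) := by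
  have hsym := Matrix.isSymmetric_toEuclideanLin_iff.mpr hL.1
  have hd := sub_le_of_hasGradientAt_neg hG hg u v
  have hlin : ∀ w, Matrix.toEuclideanLin (stabMatrix L κ) w
      = Matrix.toEuclideanLin L w + κ • w := by
    intro w
    simp [stabMatrix]
  have e1 : inner ℝ (v - u)
      (τ • stabNonlin g κ u - (τ / 2) • Matrix.toEuclideanLin (stabMatrix L κ) (u + v))
      = τ * (inner ℝ (g u) (v - u) - (1 / 2) * (inner ℝ v (Matrix.toEuclideanLin L v)
        - inner ℝ u (Matrix.toEuclideanLin L u)) - κ / 2 * ‖v - u‖ ^ 2) := by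
    have e2 : inner ℝ u (Matrix.toEuclideanLin L v) = inner ℝ v (Matrix.toEuclideanLin L u) := by
      rw [← hsym, real_inner_comm]
    rw [hlin, stabNonlin, ← real_inner_self_eq_norm_sq, real_inner_comm (v - u) (g u)]
    simp only [inner_sub_left, inner_sub_right, inner_add_right, inner_smul_right, map_add,
      smul_add]
    rw [e2, real_inner_comm v u]
    ring
  rw [e1, energy, energy, ← mul_assoc, neg_mul, one_div_mul_cancel hτ.ne']
  nlinarith [sq_nonneg ‖v - u‖]

lemma energy_sub_le_dissipation {a : ℕ → ℕ → ℝ → ℝ} {L : Matrix ι ι ℝ} (hL : L.PosDef)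
    {g : EuclideanSpace ℝ ι → EuclideanSpace ℝ ι} {G : EuclideanSpace ℝ ι → ι → ℝ}
    (hG : ∀ v, HasGradientAt (fun w => ∑ i, G w i) (-(g v)) v)
    {ℓ : ℝ≥0} (hg : LipschitzWith ℓ g) {κ : ℝ} (hκ : 2 * (ℓ : ℝ) ≤ κ) (hκ0 : 0 < κ)
    {τ : ℝ} (hτ : 0 < τ) (ha : ∀ z < 0, a 2 1 z ≠ 0 ∧ a 3 2 z ≠ 0 ∧ a 4 3 z ≠ 0)
    {U : ℕ → EuclideanSpace ℝ ι} (hU : IsStep a 3 L g κ τ U) {j : ℕ}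
    (hj : j ∈ Finset.Icc 1 3) :
    energy L G (U (j + 1)) - energy L G (U 1) ≤ -(1 / τ) * dissipation a L κ τ U j := by
  obtain ⟨hj1, hj3⟩ := Finset.mem_Icc.1 hj
  have htel : energy L G (U (j + 1)) - energy L G (U 1)
      = ∑ k ∈ Finset.Icc 1 j, (energy L G (U (k + 1)) - energy L G (U k)) := by
    rw [← Finset.Ico_add_one_right_eq_Icc,
      Finset.sum_Ico_sub (fun k => energy L G (U k)) (by omega)]
  rw [htel, dissipation, Finset.mul_sum]
  refine Finset.sum_le_sum fun k hk => ?_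
  obtain ⟨hk1, hkj⟩ := Finset.mem_Icc.1 hk
  rw [sum_matFun_dEntry hL hκ0 hτ ha hU (Finset.mem_Icc.2 ⟨hk1, hkj.trans hj3⟩)]
  exact energy_sub_le hL hG hg hκ hτ (U k) (U (k + 1))

end Problem

end EERK

theorem mainTheorem6 (c₂ : ℝ) (hc₂ : c₂ ∈ Set.Icc (4 / 9 : ℝ) 1) :
    (∀ z : ℝ, z < 0 →
      EERK.diffMatrix (EERK.eerk31 c₂) 3 z =
        !![1 / (c₂ * EERK.phi 1 (c₂ * z)) + z / 2, 0, 0;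
          9 * c₂ / (4 * EERK.phi 2 (2 / 3 * z)) + 1 / (c₂ * EERK.phi 1 (c₂ * z))
              - 3 * EERK.phi 1 (2 / 3 * z)
                / (2 * EERK.phi 2 (2 / 3 * z) * EERK.phi 1 (c₂ * z)) + z,
            9 * c₂ / (4 * EERK.phi 2 (2 / 3 * z)) + z / 2, 0;
          (2 * c₂ * EERK.phi 1 (c₂ * z) - 2 * EERK.phi 1 z + 3 * EERK.phi 2 z)
              / (3 * c₂ * EERK.phi 1 (c₂ * z) * EERK.phi 2 z) + z,
            2 / (3 * EERK.phi 2 z) + z, 2 / (3 * EERK.phi 2 z) + z / 2] ∧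
      (EERK.symPart (EERK.diffMatrix (EERK.eerk31 c₂) 3 z)).PosDef) ∧
    ∀ (ι : Type*) [Fintype ι] [DecidableEq ι]
      (L : Matrix ι ι ℝ) (_ : L.PosDef)
      (g : EuclideanSpace ℝ ι → EuclideanSpace ℝ ι) (G : EuclideanSpace ℝ ι → ι → ℝ)
      (_ : ∀ v i, 0 ≤ G v i)
      (_ : ∀ v, HasGradientAt (fun w => ∑ i, G w i) (-(g v)) v)
      (ℓ : ℝ≥0) (_ : 0 < ℓ) (_ : LipschitzWith ℓ g)
      (κ : ℝ) (_ : 2 * (ℓ : ℝ) ≤ κ)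
      (τ : ℕ → ℝ) (_ : ∀ n, 0 < τ n)
      (u : ℕ → EuclideanSpace ℝ ι) (U : ℕ → ℕ → EuclideanSpace ℝ ι)
      (_ : EERK.IsNumericalSolution (EERK.eerk31 c₂) 3 L g κ τ u U),
      ∀ n, 1 ≤ n →
        (∀ j ∈ Finset.Icc 1 3,
          EERK.energy L G (U n (j + 1)) - EERK.energy L G (U n 1)
              ≤ -(1 / τ n) * EERK.dissipation (EERK.eerk31 c₂) L κ (τ n) (U n) j ∧
          0 ≤ EERK.dissipation (EERK.eerk31 c₂) L κ (τ n) (U n) j ∧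
          EERK.energy L G (U n (j + 1)) ≤ EERK.energy L G (U n 1)) ∧
        EERK.energy L G (u n) ≤ EERK.energy L G (u (n - 1)) := by
  have hc : 0 < c₂ := lt_of_lt_of_le (by norm_num) hc₂.1
  refine ⟨fun z hz => ⟨EERK.diffMatrix_eerk31 hc hz, EERK.posDef_symPart hc₂ hz⟩, ?_⟩
  intro ι _ _ L hL g G _ hG ℓ hℓ hg κ hκ τ hτ u U hU n hn
  obtain ⟨hU1, hstep, hun⟩ := hU n hn
  have hκ0 : 0 < κ := by
    have : (0 : ℝ) < ℓ := hℓ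
    linarith
  have hlaw := fun j hj =>
    EERK.energy_sub_le_dissipation hL hG hg hκ hκ0 (hτ n) (EERK.eerk31_ne_zero hc) hstep (j := j) hj
  have hdiss := fun j hj => EERK.dissipation_nonneg hL hκ0 (hτ n)
    (EERK.dEntry_form_nonneg hc₂) (U n) (j := j) hj
  have hmono : ∀ j ∈ Finset.Icc 1 3,
      EERK.energy L G (U n (j + 1)) ≤ EERK.energy L G (U n 1) := by
    intro j hj
    have h := mul_nonneg (one_div_pos.2 (hτ n)).le (hdiss j hj)
    linarith [hlaw j hj]
  refine ⟨fun j hj => ⟨hlaw j hj, hdiss j hj, hmono j hj⟩, ?_⟩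
  rw [hun, ← hU1]
  exact hmono 3 (by simp)
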